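/- Let $k$ be a field and $R=k[x,y,z]$. Let $I\subset R$ be an ideal of codimension (height) $2$ which is perfect (that is, the projective dimension of $R/I$ equals the grade of $I$) and minimally generated by $n$ monomials of degree $n-1$. Call a matrix $\phi$ of linear forms of $R$ a linear syzygy matrix of $I$ if its columns minimally generate the module of syzygies of some minimal set of generators of $I$ consisting of forms of one and the same degree, and assume that $I$ is linearly presented, i.e. that it has a linear syzygy matrix. Assume moreover that $I$ has exactly two minimal primes. Then $I$ has a linear syzygy matrix of size $n\times(n-1)$, and there are $c_1,\ldots,c_{n-1}\in\{x,y\}$ such that every $n\times(n-1)$ linear syzygy matrix of $I$ is conjugate to the $n\times(n-1)$ matrix $$\varphi=\left(\begin{array}{cccc} z&0&\cdots&0\\ -c_1&z&\cdots&0\\ 0&-c_2&\ddots&\vdots\\ \vdots&\vdots&\ddots&z\\ 0&0&\cdots&-c_{n-1} \end{array}\right),$$ with $\varphi_{j,j}=z$ and $\varphi_{j+1,j}=-c_j$ for $1\le j\le n-1$ and all other entries zero. Here two $n\times(n-1)$ matrices of linear forms are conjugate if they lie in the same orbit of $\mathrm{GL}_3(k)\times \mathrm{GL}_n(k)\times \mathrm{GL}_{n-1}(k)$,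 acting by linear changes of the variables $x,y,z$, row operations and column operations. -/

import Mathlib

namespace MonomialSyzygy

open MvPolynomial

/-- The polynomial ring `k[x, y, z]`, with `x = X 0`, `y = X 1`, `z = X 2`. -/
abbrev Poly3 (k : Type*) [Field k] : Type _ := MvPolynomial (Fin 3) k

/-- The family `v` is a minimal (irredundant) generating family of the submodule `N`. -/
def IsMinimalGenerating {R M ι : Type*} [CommRing R] [AddCommGroup M] [Module R M]
    (N : Submodule R M) (v : ι → M) : Prop :=
  Submodule.span R (Set.range v) = N ∧ ∀ i, v i ∉ Submodule.span R (v '' {i}ᶜ)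

/-- The module of syzygies of `f₁, …, fₙ`: all `(v₁, …, vₙ)` with `∑ vᵢ fᵢ = 0`. -/
noncomputable def syzygies {R : Type*} [CommRing R] {n : ℕ} (f : Fin n → R) :
    Submodule R (Fin n → R) :=
  LinearMap.ker (Fintype.linearCombination R f)

/-- `φ` is a linear syzygy matrix of `I`: its entries are linear forms, and its columns minimally
generate the syzygies of some minimal generators `f₁, …, fₙ` of `I`, which are forms of one and
the same degree. -/
def IsLinearSyzygyMatrix {k : Type*} [Field k] {n m : ℕ} (I : Ideal (Poly3 k))
    (φ : Matrix (Fin n) (Fin m) (Poly3 k)) : Prop :=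
  (∀ i j, (φ i j).IsHomogeneous 1) ∧
  ∃ (d : ℕ) (f : Fin n → Poly3 k),
    (∀ i, (f i).IsHomogeneous d) ∧ IsMinimalGenerating I f ∧
      IsMinimalGenerating (syzygies f) φ.col

/-- `I` is linearly presented: it has a syzygy matrix whose entries are linear forms. -/
def IsLinearlyPresented {k : Type*} [Field k] (I : Ideal (Poly3 k)) : Prop :=
  ∃ (n m : ℕ) (φ : Matrix (Fin n) (Fin m) (Poly3 k)), IsLinearSyzygyMatrix I φ

/-- The grade of an ideal: the supremum of the lengths of the regular sequences inside it. -/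
noncomputable def grade {R : Type*} [CommRing R] (I : Ideal R) : ℕ∞ :=
  ⨆ rs : {rs : List R // (∀ r ∈ rs, r ∈ I) ∧ RingTheory.Sequence.IsRegular R rs},
    (rs.1.length : ℕ∞)

/-- `I` is perfect: the projective dimension of `R/I` equals the grade of `I`. -/
def IsPerfect {R : Type*} [CommRing R] (I : Ideal R) : Prop :=
  CategoryTheory.projectiveDimension (ModuleCat.of R (R ⧸ I)) = (grade I : WithBot ℕ∞)

/-- The `k`-algebra endomorphism of `k[x, y, z]` sending the `i`-th variable to the linear form
`∑ⱼ gᵢⱼ Xⱼ`. -/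
noncomputable def changeVars {k : Type*} [Field k] (g : Matrix (Fin 3) (Fin 3) k) :
    Poly3 k →ₐ[k] Poly3 k :=
  aeval fun i => ∑ j, C (g i j) * X j

/-- Two matrices over `k[x, y, z]` are conjugate if one is obtained from the other by an
invertible linear change of variables and invertible row and column operations over `k`. -/
def IsConjugate {k : Type*} [Field k] {n m : ℕ}
    (φ ψ : Matrix (Fin n) (Fin m) (Poly3 k)) : Prop :=
  ∃ (g : GL (Fin 3) k) (P : GL (Fin n) k) (Q : GL (Fin m) k),
    ψ = (P.val.map C : Matrix (Fin n) (Fin n) (Poly3 k)) * φ.map (changeVars g.val) *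
      (Q.val.map C : Matrix (Fin m) (Fin m) (Poly3 k))

/-- The `n × (n-1)` matrix with `z` on the diagonal, `-c₁, …, -cₙ₋₁` just below the diagonal, and
`0` elsewhere. -/
noncomputable def bidiagonal {k : Type*} [Field k] {n : ℕ} (c : Fin (n - 1) → Poly3 k) :
    Matrix (Fin n) (Fin (n - 1)) (Poly3 k) :=
  fun i j => if i.val = j.val then X 2 else if i.val = j.val + 1 then -c j else 0

end MonomialSyzygy

/-! Each coordinate axis has a prime of height at most 2. If all three contained `I`, all three
would be minimal over `I`; so `I` avoids one of them, and some generator is a pure power of a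
variable `X t` (`exists_pure_power`). Since `I` has height 2, some generator is free of `X t`
(`exists_exponent_eq_zero`).

Order the generators by their exponent of `X t`. Linear syzygies cannot jump over a level, so every
cut between levels is crossed by a relation `X t * m = X c * m'` with `c ≠ t` (`exists_adjacent`).
With `N + 1` generators of degree `N`, each level from 0 to `N` then holds exactly one generator,
and the generators form a chain (`exists_equiv_chain`). Elimination on divisibility by `X t` shows
that the chain relations generate all syzygies (`isMinimalGenerating_bidiag`); they form the
bidiagonal matrix.

Minimal generators in a single degree are unique up to `GL` over `k`, so every other linear syzygy
matrix differs by row and column operations; swapping `X t` with `z` gives the stated form. -/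

namespace MonomialSyzygy

open MvPolynomial

/-! ### Uniqueness of minimal generators over the base field -/

section MinimalGenerators

variable {k R M : Type*} [Field k] [CommRing R] [AddCommGroup M] [Module R M] [Module k M]

/-- If `π` projects onto a homogeneous piece `W`, a family in `W` lying in the `R`-span of another
family in `W` already lies in its `k`-span. -/
theorem mem_span_of_projection {ι : Type*} [Fintype ι] (ε : R → k) (π : M →ₗ[k] M) (W : Set M)
    (hW : ∀ w ∈ W, π w = w) (hπ : ∀ (a : R), ∀ w ∈ W, π (a • w) = ε a • w)
    {u : ι → M} (hu : ∀ i, u i ∈ W)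
    {w : M} (hw : w ∈ W) (hwu : w ∈ Submodule.span R (Set.range u)) :
    w ∈ Submodule.span k (Set.range u) := by
  obtain ⟨c, rfl⟩ := (Submodule.mem_span_range_iff_exists_fun R).1 hwu
  rw [← hW _ hw, map_sum]
  refine Submodule.sum_mem _ fun i _ => ?_
  rw [hπ _ _ (hu i)]
  exact Submodule.smul_mem _ _ (Submodule.subset_span ⟨i, rfl⟩)

variable [Algebra k R] [IsScalarTower k R M]

theorem IsMinimalGenerating.linearIndependent {ι : Type*} {N : Submodule R M} {u : ι → M}
    (hu : IsMinimalGenerating N u) : LinearIndependent k u := by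
  rw [linearIndependent_iff_notMem_span]
  intro i hi
  refine hu.2 i (Submodule.span_le_restrictScalars k R (u '' {i}ᶜ) ?_)
  rwa [Set.compl_eq_univ_sdiff]

theorem IsMinimalGenerating.comp_equiv {ι κ : Type*} {N : Submodule R M} {u : ι → M}
    (hu : IsMinimalGenerating N u) (τ : κ ≃ ι) : IsMinimalGenerating N (u ∘ τ) := by
  refine ⟨by rw [EquivLike.range_comp]; exact hu.1, fun i => ?_⟩
  rw [Set.image_comp, Set.image_compl_eq τ.bijective, Set.image_singleton]
  exact hu.2 (τ i)

theorem IsMinimalGenerating.of_linearIndependent [Nontrivial R] {ι : Type*} {N : Submodule R M}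
    {u : ι → M} (hspan : Submodule.span R (Set.range u) = N) (hu : LinearIndependent R u) :
    IsMinimalGenerating N u :=
  ⟨hspan, fun _ => hu.notMem_span_image (by simp)⟩

theorem IsMinimalGenerating.map_equiv {ι M' : Type*} [AddCommGroup M'] [Module R M']
    {N : Submodule R M} {u : ι → M} (hu : IsMinimalGenerating N u) (e : M ≃ₗ[R] M') :
    IsMinimalGenerating (N.map (e : M →ₗ[R] M')) (fun i => e (u i)) := by
  refine ⟨?_, fun i hi => hu.2 i ?_⟩
  · rw [← hu.1, Submodule.map_span, ← Set.range_comp]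
    rfl
  · have : (fun i => e (u i)) '' {i}ᶜ = (e : M →ₗ[R] M') '' (u '' {i}ᶜ) := by
      rw [← Set.image_comp]; rfl
    rw [this, ← Submodule.map_span] at hi
    obtain ⟨w, hw, hwe⟩ := hi
    rwa [← e.injective hwe]

/-- Both families are `k`-bases of the same space, their common `k`-span. -/
theorem card_eq_of_isMinimalGenerating (ε : R → k) (π : M →ₗ[k] M) (W : Set M)
    (hW : ∀ w ∈ W, π w = w) (hπ : ∀ (a : R), ∀ w ∈ W, π (a • w) = ε a • w)
    {N : Submodule R M} {n m : ℕ} {u : Fin n → M} {v : Fin m → M}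
    (hu : ∀ i, u i ∈ W) (hv : ∀ i, v i ∈ W)
    (hNu : IsMinimalGenerating N u) (hNv : IsMinimalGenerating N v) : n = m := by
  have huv : Submodule.span k (Set.range u) = Submodule.span k (Set.range v) := by
    apply le_antisymm <;> rw [Submodule.span_le] <;> rintro _ ⟨i, rfl⟩
    · refine mem_span_of_projection ε π W hW hπ hv (hu i) ?_
      rw [hNv.1, ← hNu.1]; exact Submodule.subset_span ⟨i, rfl⟩
    · refine mem_span_of_projection ε π W hW hπ hu (hv i) ?_
      rw [hNu.1, ← hNv.1]; exact Submodule.subset_span ⟨i, rfl⟩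
  have h1 := finrank_span_eq_card (hNu.linearIndependent (k := k))
  have h2 := finrank_span_eq_card (hNv.linearIndependent (k := k))
  rw [huv, h2] at h1
  simpa using h1.symm

/-- Each family is a `k`-combination of the other, and independence over `k` makes the two
transition matrices inverse. Keeping `ε`, `π`, `W` abstract serves both ideals and submodules of
free modules. -/
theorem exists_GL_of_isMinimalGenerating (ε : R → k) (π : M →ₗ[k] M) (W : Set M)
    (hW : ∀ w ∈ W, π w = w) (hπ : ∀ (a : R), ∀ w ∈ W, π (a • w) = ε a • w)
    {N : Submodule R M} {n : ℕ} {u v : Fin n → M} (hu : ∀ i, u i ∈ W) (hv : ∀ i, v i ∈ W)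
    (hNu : IsMinimalGenerating N u) (hNv : IsMinimalGenerating N v) :
    ∃ P : GL (Fin n) k, ∀ i, v i = ∑ j, P.val i j • u j := by
  have key : ∀ {u v : Fin n → M}, (∀ i, u i ∈ W) → (∀ i, v i ∈ W) → IsMinimalGenerating N u →
      IsMinimalGenerating N v → ∃ P : Matrix (Fin n) (Fin n) k, ∀ i, ∑ j, P i j • u j = v i := by
    intro u v hu hv hNu hNv
    have hex (i : Fin n) : ∃ c : Fin n → k, ∑ j, c j • u j = v i := by
      refine (Submodule.mem_span_range_iff_exists_fun k).1
        (mem_span_of_projection ε π W hW hπ hu (hv i) ?_)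
      rw [hNu.1, ← hNv.1]; exact Submodule.subset_span ⟨i, rfl⟩
    choose P hP using hex
    exact ⟨P, hP⟩
  have mul_eq : ∀ {u v : Fin n → M} {P Q : Matrix (Fin n) (Fin n) k}, LinearIndependent k u →
      (∀ i, ∑ j, P i j • u j = v i) → (∀ i, ∑ j, Q i j • v j = u i) → Q * P = 1 := by
    intro u v P Q hu hP hQ
    ext i l
    refine Fintype.linearIndependent_iffₛ.1 hu ((Q * P) i) ((1 : Matrix _ _ k) i) ?_ l
    simp only [Matrix.mul_apply, Finset.sum_smul, mul_smul, Matrix.one_apply, ite_smul, one_smul,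
      zero_smul, Finset.sum_ite_eq, Finset.mem_univ, if_true]
    rw [Finset.sum_comm, ← hQ i]
    refine Finset.sum_congr rfl fun j _ => ?_
    rw [← hP j, Finset.smul_sum]
  obtain ⟨P, hP⟩ := key hu hv hNu hNv
  obtain ⟨Q, hQ⟩ := key hv hu hNv hNu
  exact ⟨⟨P, Q, mul_eq hNv.linearIndependent hQ hP, mul_eq hNu.linearIndependent hP hQ⟩,
    fun i => (hP i).symm⟩

end MinimalGenerators

/-! ### Generators that are forms of one degree -/

section Homogeneous

variable {k : Type*} [Field k]

/-- Only the degree 0 part of `a` keeps `w` in degree `d`. -/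
theorem homogeneousComponent_mul_of_isHomogeneous {σ : Type*} {d : ℕ} (a : MvPolynomial σ k)
    {w : MvPolynomial σ k} (hw : w.IsHomogeneous d) :
    homogeneousComponent d (a * w) = constantCoeff a • w := by
  have ha := sum_homogeneousComponent a
  conv_lhs => rw [← ha, Finset.sum_mul, map_sum]
  have hcomp (i : ℕ) : homogeneousComponent d (homogeneousComponent i a * w) =
      if d = i + d then homogeneousComponent i a * w else 0 :=
    homogeneousComponent_of_mem ((homogeneousComponent_isHomogeneous i a).mul hw)
  rw [Finset.sum_eq_single 0]
  · rw [hcomp]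
    simp [homogeneousComponent_zero, smul_eq_C_mul, constantCoeff_eq]
  · intro i _ hi
    rw [hcomp, if_neg (by omega)]
  · simp

/-- Homogeneous minimal generators of an ideal, all of degree `d`, are unique up to `GL`. -/
theorem exists_GL_of_ideal {d n : ℕ} {I : Ideal (Poly3 k)} {f g : Fin n → Poly3 k}
    (hf : ∀ i, (f i).IsHomogeneous d) (hg : ∀ i, (g i).IsHomogeneous d)
    (hIf : IsMinimalGenerating I f) (hIg : IsMinimalGenerating I g) :
    ∃ P : GL (Fin n) k, ∀ i, g i = ∑ j, P.val i j • f j :=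
  exists_GL_of_isMinimalGenerating constantCoeff (homogeneousComponent d)
    {p | p.IsHomogeneous d}
    (fun w hw => by rw [homogeneousComponent_of_mem hw, if_pos rfl])
    (fun a _ hw => homogeneousComponent_mul_of_isHomogeneous a hw) hf hg hIf hIg

theorem card_eq_of_ideal {d n m : ℕ} {I : Ideal (Poly3 k)} {f : Fin n → Poly3 k}
    {g : Fin m → Poly3 k}
    (hf : ∀ i, (f i).IsHomogeneous d) (hg : ∀ i, (g i).IsHomogeneous d)
    (hIf : IsMinimalGenerating I f) (hIg : IsMinimalGenerating I g) : n = m :=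
  card_eq_of_isMinimalGenerating constantCoeff (homogeneousComponent d)
    {p | p.IsHomogeneous d}
    (fun w hw => by rw [homogeneousComponent_of_mem hw, if_pos rfl])
    (fun a _ hw => homogeneousComponent_mul_of_isHomogeneous a hw) hf hg hIf hIg

/-- Minimal generators of a submodule of a free module whose entries are forms of degree `d` are
unique up to `GL`. -/
theorem exists_GL_of_pi {d n m : ℕ} {N : Submodule (Poly3 k) (Fin n → Poly3 k)}
    {u v : Fin m → Fin n → Poly3 k}
    (hu : ∀ i j, (u i j).IsHomogeneous d) (hv : ∀ i j, (v i j).IsHomogeneous d)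
    (hNu : IsMinimalGenerating N u) (hNv : IsMinimalGenerating N v) :
    ∃ P : GL (Fin m) k, ∀ i, v i = ∑ j, P.val i j • u j :=
  exists_GL_of_isMinimalGenerating constantCoeff
    (LinearMap.pi fun j => homogeneousComponent d ∘ₗ LinearMap.proj j)
    {p | ∀ j, (p j).IsHomogeneous d}
    (fun w hw => by
      ext1 j
      exact (homogeneousComponent_of_mem (hw j)).trans (if_pos rfl))
    (fun a _ hw => by
      ext1 j
      exact homogeneousComponent_mul_of_isHomogeneous a (hw j)) hu hv hNu hNv

/-- Forms of degree `d'` in an ideal generated by forms of degree `d` vanish if `d' < d`. -/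
theorem le_degree_of_mem_span {d d' n : ℕ} {f : Fin n → Poly3 k} {g : Poly3 k}
    (hf : ∀ i, (f i).IsHomogeneous d) (hg : g.IsHomogeneous d') (hg0 : g ≠ 0)
    (hmem : g ∈ Ideal.span (Set.range f)) : d ≤ d' := by
  by_contra! hlt
  obtain ⟨c, rfl⟩ := (Submodule.mem_span_range_iff_exists_fun _).1 hmem
  have hg' := homogeneousComponent_of_mem (m := d') hg
  rw [if_pos rfl] at hg'
  apply hg0
  rw [← hg', map_sum]
  refine Finset.sum_eq_zero fun i _ => ?_
  rw [smul_eq_mul, ← sum_homogeneousComponent (c i), Finset.sum_mul, map_sum]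
  refine Finset.sum_eq_zero fun l _ => ?_
  rw [homogeneousComponent_of_mem ((homogeneousComponent_isHomogeneous l (c i)).mul (hf i)),
    if_neg (by omega)]

theorem IsMinimalGenerating.ne_zero {R M ι : Type*} [CommRing R] [AddCommGroup M] [Module R M]
    {N : Submodule R M} {v : ι → M} (h : IsMinimalGenerating N v) (i : ι) : v i ≠ 0 :=
  fun h0 => h.2 i (h0 ▸ Submodule.zero_mem _)

/-- Either degree is the least degree of a nonzero form in `I`. -/
theorem degree_eq_of_ideal {d d' n m : ℕ} {I : Ideal (Poly3 k)} (hI : I ≠ ⊥)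
    {f : Fin n → Poly3 k} {g : Fin m → Poly3 k}
    (hf : ∀ i, (f i).IsHomogeneous d) (hg : ∀ i, (g i).IsHomogeneous d')
    (hIf : IsMinimalGenerating I f) (hIg : IsMinimalGenerating I g) : d = d' := by
  have nonempty : ∀ {n : ℕ} {f : Fin n → Poly3 k}, IsMinimalGenerating I f → Nonempty (Fin n) := by
    intro n f hIf
    by_contra hn
    rw [not_nonempty_iff] at hn
    exact hI (by rw [← hIf.1, Set.range_eq_empty, Submodule.span_empty])
  obtain ⟨i⟩ := nonempty hIf
  obtain ⟨j⟩ := nonempty hIg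
  apply le_antisymm
  · refine le_degree_of_mem_span hf (hg j) (hIg.ne_zero j) ?_
    rw [Ideal.span, hIf.1, ← hIg.1]; exact Submodule.subset_span ⟨j, rfl⟩
  · refine le_degree_of_mem_span hg (hf i) (hIf.ne_zero i) ?_
    rw [Ideal.span, hIg.1, ← hIf.1]; exact Submodule.subset_span ⟨i, rfl⟩

end Homogeneous

/-! ### Syzygies under a change of generators -/

section Transfer

variable {k : Type*} [Field k] {n m : ℕ}

theorem mem_syzygies {R : Type*} [CommRing R] {f : Fin n → R} {v : Fin n → R} :
    v ∈ syzygies f ↔ ∑ i, v i * f i = 0 := by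
  simp [syzygies, Fintype.linearCombination_apply]

/-- If `f = P m` with `P` invertible over `k`, then `v ↦ Pᵀ v` carries minimal generators of the
syzygies of `f` to minimal generators of the syzygies of `m`. -/
theorem isMinimalGenerating_syzygies_transpose_mul {f g : Fin n → Poly3 k} (P : GL (Fin n) k)
    (hP : ∀ i, f i = ∑ j, P.val i j • g j) {φ : Matrix (Fin n) (Fin m) (Poly3 k)}
    (hφ : IsMinimalGenerating (syzygies f) φ.col) :
    IsMinimalGenerating (syzygies g)
      ((P.val.transpose.map C : Matrix (Fin n) (Fin n) (Poly3 k)) * φ).col := by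
  set A : Matrix (Fin n) (Fin n) (Poly3 k) := P.val.transpose.map C with hA
  set B : Matrix (Fin n) (Fin n) (Poly3 k) := P⁻¹.val.transpose.map C with hB
  have hAB : A * B = 1 := by
    rw [hA, hB, ← Matrix.map_mul, ← Matrix.transpose_mul, ← Units.val_mul, inv_mul_cancel]
    rw [Units.val_one, Matrix.transpose_one, Matrix.map_one _ C_0 C_1]
  have hBA : B * A = 1 := by
    rw [hA, hB, ← Matrix.map_mul, ← Matrix.transpose_mul, ← Units.val_mul, mul_inv_cancel]
    rw [Units.val_one, Matrix.transpose_one, Matrix.map_one _ C_0 C_1]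
  let e : (Fin n → Poly3 k) ≃ₗ[Poly3 k] (Fin n → Poly3 k) :=
    Matrix.toLin'OfInv hBA hAB
  have he (v : Fin n → Poly3 k) : e v = A.mulVec v := rfl
  -- Adjointness, `(Pᵀ v) · g = v · (P g)`, explains the transpose.
  have hsum (v : Fin n → Poly3 k) : ∑ i, e v i * g i = ∑ i, v i * f i := by
    simp only [he, Matrix.mulVec, dotProduct, hP, Finset.sum_mul, Finset.mul_sum]
    rw [Finset.sum_comm]
    refine Finset.sum_congr rfl fun i _ => Finset.sum_congr rfl fun j _ => ?_
    simp only [hA, Matrix.map_apply, Matrix.transpose_apply, smul_eq_C_mul]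
    ring
  have hmap : (syzygies f).map (e : (Fin n → Poly3 k) →ₗ[Poly3 k] _) = syzygies g := by
    ext w
    constructor
    · rintro ⟨v, hv, rfl⟩
      exact mem_syzygies.2 ((hsum v).trans (mem_syzygies.1 hv))
    · intro hw
      refine ⟨e.symm w, mem_syzygies.2 ?_, e.apply_symm_apply w⟩
      rw [← hsum, e.apply_symm_apply]
      exact mem_syzygies.1 hw
  rw [← hmap]
  have hcol : (A * φ).col = fun i => e (φ.col i) := by
    ext1 j
    rfl
  rw [hcol]
  exact hφ.map_equiv e

end Transfer

/-! ### Axis primes and extremal generators -/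

section Primes

variable {k : Type*} [Field k]

/-- The prime ideal of the coordinate axis in direction `t`, generated by the other variables. -/
noncomputable def axisIdeal (k : Type*) [Field k] (t : Fin 3) : Ideal (Poly3 k) :=
  RingHom.ker (aeval (Pi.single t Polynomial.X) : Poly3 k →ₐ[k] Polynomial k)

instance axisIdeal_isPrime (t : Fin 3) : (axisIdeal k t).IsPrime :=
  RingHom.ker_isPrime _

theorem monomial_mem_axisIdeal {t i : Fin 3} (hi : i ≠ t) {e : Fin 3 →₀ ℕ} (he : e i ≠ 0) :
    monomial e (1 : k) ∈ axisIdeal k t := by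
  rw [axisIdeal, RingHom.mem_ker, aeval_monomial, Finsupp.prod,
    Finset.prod_eq_zero (Finsupp.mem_support_iff.2 he), mul_zero]
  rw [Pi.single_eq_of_ne hi, zero_pow he]

theorem X_mem_axisIdeal_iff {t i : Fin 3} : X i ∈ axisIdeal k t ↔ i ≠ t := by
  rw [axisIdeal, RingHom.mem_ker, aeval_X]
  constructor
  · rintro h rfl
    simp at h
  · exact fun h => Pi.single_eq_of_ne h _

theorem axisIdeal_injective : Function.Injective (axisIdeal k) := by
  intro s t h
  by_contra hst
  exact X_mem_axisIdeal_iff.1 (h ▸ X_mem_axisIdeal_iff.2 hst) rfl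

/-- The axis prime lies strictly below the ideal of the origin, whose height is at most the
dimension 3. -/
theorem height_axisIdeal_le (t : Fin 3) : (axisIdeal k t).height ≤ 2 := by
  set m : Ideal (Poly3 k) := RingHom.ker (constantCoeff : Poly3 k →+* k) with hm
  have : m.IsPrime := RingHom.ker_isPrime _
  have hle : axisIdeal k t ≤ m := by
    intro p hp
    rw [axisIdeal, RingHom.mem_ker] at hp
    have h := congrArg (Polynomial.aeval (0 : k)) hp
    rw [map_zero, ← AlgHom.comp_apply, comp_aeval] at h
    have h0 : (fun i => Polynomial.aeval (0 : k)
        ((Pi.single t Polynomial.X : Fin 3 → Polynomial k) i)) = 0 := by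
      ext i
      by_cases hi : i = t
      · subst hi; simp
      · simp [hi]
    rw [h0, aeval_zero] at h
    exact h
  have hlt : axisIdeal k t < m := by
    refine lt_of_le_of_ne hle fun h => ?_
    have hX : (X t : Poly3 k) ∈ m := by simp [hm]
    exact X_mem_axisIdeal_iff.1 (h ▸ hX) rfl
  have h1 := Ideal.height_add_one_le_of_lt_of_isPrime hlt
  have h2 : (m.height : WithBot ℕ∞) ≤ 3 := by
    refine Ideal.height_le_ringKrullDim_of_isPrime.trans ?_
    rw [MvPolynomial.ringKrullDim_of_isNoetherianRing]
    simp
  have h3 : m.height ≤ 3 := WithBot.coe_le_coe.1 h2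
  have h4 : (axisIdeal k t).height + 1 ≤ 2 + 1 := h1.trans (h3.trans (by norm_num))
  exact (ENat.add_le_add_iff_right ENat.one_ne_top).1 h4

/-- An ideal of height two with exactly two minimal primes avoids one of the axis primes. -/
theorem exists_not_le_axisIdeal {I : Ideal (Poly3 k)} (hI : I.height = 2)
    (hmin : I.minimalPrimes.ncard = 2) : ∃ t, ¬ I ≤ axisIdeal k t := by
  by_contra! hle
  have hsub : Set.range (axisIdeal k) ⊆ I.minimalPrimes := by
    rintro _ ⟨t, rfl⟩
    exact Ideal.mem_minimalPrimes_of_height_le (hle t) (hI ▸ height_axisIdeal_le t)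
  have h := Set.ncard_le_ncard hsub (Set.finite_of_ncard_ne_zero (by omega))
  rw [hmin, ← Set.image_univ, Set.ncard_image_of_injective _ axisIdeal_injective,
    Set.ncard_univ] at h
  simp at h

/-- If every generator involved a variable other than `X t`, the axis prime of `t` would contain
`I`. -/
theorem exists_pure_power {ι : Type*} {I : Ideal (Poly3 k)} (hI : I.height = 2)
    (hmin : I.minimalPrimes.ncard = 2) {e : ι → Fin 3 →₀ ℕ}
    (he : Ideal.span (Set.range fun i => monomial (e i) (1 : k)) = I) :
    ∃ t i, ∀ j, j ≠ t → e i j = 0 := by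
  obtain ⟨t, ht⟩ := exists_not_le_axisIdeal hI hmin
  refine ⟨t, ?_⟩
  by_contra! h
  apply ht
  rw [← he, Ideal.span_le]
  rintro _ ⟨i, rfl⟩
  obtain ⟨j, hj, hj0⟩ := h i
  exact monomial_mem_axisIdeal hj hj0

/-- Otherwise `X t` divides all of `I`, and Krull's principal ideal theorem bounds the height by 1.
-/
theorem exists_exponent_eq_zero {ι : Type*} {I : Ideal (Poly3 k)} (hI : I.height = 2)
    {e : ι → Fin 3 →₀ ℕ} (he : Ideal.span (Set.range fun i => monomial (e i) (1 : k)) = I)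
    (t : Fin 3) : ∃ i, e i t = 0 := by
  by_contra! h
  have hle : I ≤ Ideal.span {X t} := by
    rw [← he, Ideal.span_le]
    rintro _ ⟨i, rfl⟩
    exact Ideal.mem_span_singleton.2 (X_dvd_monomial.2 (Or.inr (h i)))
  have h1 := (Ideal.height_mono hle).trans
    (Ideal.height_span_singleton_le_one (X_prime (i := t) (R := k)).not_isUnit)
  rw [hI] at h1
  exact absurd h1 (by decide)

end Primes

/-! ### Linear syzygies connect consecutive levels -/

section Levels

variable {k : Type*} [Field k] {n : ℕ}

/-- If the syzygies of monomials `X ^ e i` are generated by linear ones, any cut between two levels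
of the exponent of `X t` is crossed by a linear syzygy. -/
theorem exists_adjacent {e : Fin n → Fin 3 →₀ ℕ} {L : Set (Fin n → Poly3 k)}
    (hL : Submodule.span (Poly3 k) L = syzygies fun i => monomial (e i) (1 : k))
    (hlin : ∀ v ∈ L, ∀ i, (v i).IsHomogeneous 1) (t : Fin 3) (a : ℕ)
    {i₀ i₁ : Fin n} (h₀ : e i₀ t ≤ a) (h₁ : a < e i₁ t) :
    ∃ i j c, e i t = a ∧ e j t = a + 1 ∧ c ≠ t ∧
      e i + Finsupp.single t 1 = e j + Finsupp.single c 1 := by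
  by_contra! hno
  set m : Fin n → Poly3 k := fun i => monomial (e i) 1 with hm
  -- Without a crossing, the part of each syzygy supported on the levels up to `a` would be a syzygy
  -- by itself.
  let low : Finset (Fin n) := Finset.univ.filter fun i => e i t ≤ a
  let low' : (Fin n → Poly3 k) →ₗ[Poly3 k] Poly3 k :=
    ∑ i ∈ low, (LinearMap.proj i).smulRight (m i)
  have hlow' (v : Fin n → Poly3 k) : low' v = ∑ i ∈ low, v i * m i := by
    simp [low', LinearMap.sum_apply]
  have hcoeff : ∀ v ∈ L, ∀ i (d : Fin 3 →₀ ℕ), coeff d (v i * m i) ≠ 0 →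
      ∃ c, d = e i + Finsupp.single c 1 := by
    intro v hv i d hd
    rw [hm, coeff_mul_monomial'] at hd
    split_ifs at hd with hle
    · rw [mul_one] at hd
      have hdeg : (d - e i).degree = 1 :=
        (DFunLike.congr_fun Finsupp.degree_eq_weight_one _).trans (hlin v hv i hd)
      obtain ⟨c, hc⟩ := Finsupp.range_single_one.ge hdeg
      exact ⟨c, by dsimp only at hc; rw [hc, add_tsub_cancel_of_le hle]⟩
    · exact absurd rfl hd
  -- A term surviving in the low part cancels against the high part, so `X c * m i = X c' * m j`
  -- with `i` low and `j` high. Comparing exponents of `X t` forces `c = t`, `c' ≠ t` and levels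
  -- `a`, `a + 1`: a crossing.
  have hker : syzygies m ≤ LinearMap.ker low' := by
    rw [← hL, Submodule.span_le]
    intro v hv
    rw [SetLike.mem_coe, LinearMap.mem_ker, hlow']
    have hsyz : ∑ i, v i * m i = 0 := by
      rw [← mem_syzygies, ← hL]; exact Submodule.subset_span hv
    ext d
    rw [coeff_zero]
    by_contra hd
    rw [← Finset.sum_add_sum_compl low] at hsyz
    have hd' : coeff d (∑ i ∈ lowᶜ, v i * m i) ≠ 0 := by
      intro h
      have := congrArg (coeff d) hsyz
      rw [coeff_add, h, add_zero] at this
      exact hd this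
    rw [coeff_sum] at hd hd'
    obtain ⟨i, hi, hid⟩ := Finset.exists_ne_zero_of_sum_ne_zero hd
    obtain ⟨j, hj, hjd⟩ := Finset.exists_ne_zero_of_sum_ne_zero hd'
    obtain ⟨c, hc⟩ := hcoeff v hv i d hid
    obtain ⟨c', hc'⟩ := hcoeff v hv j d hjd
    have hit : e i t ≤ a := (Finset.mem_filter.1 hi).2
    have hjt : a < e j t := by
      by_contra! h
      exact Finset.mem_compl.1 hj (Finset.mem_filter.2 ⟨Finset.mem_univ _, h⟩)
    have hij := hc.symm.trans hc'
    have ht := DFunLike.congr_fun hij t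
    simp only [Finsupp.add_apply, Finsupp.single_apply] at ht
    by_cases hct : c = t <;> by_cases hct' : c' = t <;> simp only [hct, hct', if_true, if_false] at ht
    · omega
    · subst hct
      exact hno i j c' (by omega) (by omega) hct' hij
    · omega
    · omega
  let w : Fin n → Poly3 k := m i₁ • Pi.single i₀ 1 - m i₀ • Pi.single i₁ 1
  have hne : i₀ ≠ i₁ := by rintro rfl; omega
  have hw : w ∈ syzygies m := by
    rw [mem_syzygies]
    simp only [w, Pi.sub_apply, Pi.smul_apply, Pi.single_apply, smul_eq_mul, mul_ite, mul_one,
      mul_zero, sub_mul, ite_mul, zero_mul, Finset.sum_sub_distrib, Finset.sum_ite_eq',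
      Finset.mem_univ, if_true]
    ring
  have hlw := hker hw
  rw [LinearMap.mem_ker, hlow'] at hlw
  have hi₀ : i₀ ∈ low := Finset.mem_filter.2 ⟨Finset.mem_univ _, h₀⟩
  have hi₁ : i₁ ∉ low := fun h => absurd (Finset.mem_filter.1 h).2 (by omega)
  rw [Finset.sum_eq_single i₀] at hlw
  · simp [w, hne, hm] at hlw
  · intro j hj hj0
    have : j ≠ i₁ := fun h => hi₁ (h ▸ hj)
    simp [w, hj0, this]
  · exact fun h => absurd hi₀ h

/-- The exponents of the generators: one generator for each exponent of `X t`, and consecutive ones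
differ by replacing `X t` by another variable. -/
theorem exists_equiv_chain {N : ℕ} {e : Fin (N + 1) → Fin 3 →₀ ℕ} {L : Set (Fin (N + 1) → Poly3 k)}
    (hL : Submodule.span (Poly3 k) L = syzygies fun i => monomial (e i) (1 : k))
    (hlin : ∀ v ∈ L, ∀ i, (v i).IsHomogeneous 1) (t : Fin 3)
    {i₀ i₁ : Fin (N + 1)} (h₀ : e i₀ t = 0) (h₁ : e i₁ t = N) :
    ∃ (τ : Equiv.Perm (Fin (N + 1))) (c : Fin N → Fin 3), (∀ j, e (τ j) t = j) ∧
      (∀ j, c j ≠ t) ∧ ∀ j : Fin N, e (τ j.castSucc) + Finsupp.single t 1 =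
        e (τ j.succ) + Finsupp.single (c j) 1 := by
  have hadj (j : Fin N) := exists_adjacent hL hlin t j (i₀ := i₀) (i₁ := i₁) (by omega)
    (by have := j.2; omega)
  choose p q c hp hq hc hpq using hadj
  have hex (j : Fin (N + 1)) : ∃ i, e i t = j := by
    induction j using Fin.lastCases with
    | last => exact ⟨i₁, by simpa using h₁⟩
    | cast j => exact ⟨p j, by simpa using hp j⟩
  -- Pigeonhole: `N + 1` levels, all attained by `N + 1` generators, so each exactly once.
  choose τ hτ using hex
  have hinj : Function.Injective τ := fun i j h => Fin.ext (by rw [← hτ i, h, hτ j])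
  have hbij : Function.Bijective τ := Finite.injective_iff_bijective.1 hinj
  have huniq (i : Fin (N + 1)) (j : Fin (N + 1)) (h : e i t = j) : τ j = i := by
    obtain ⟨l, rfl⟩ := hbij.2 i
    rw [hτ] at h
    rw [Fin.ext h]
  refine ⟨Equiv.ofBijective τ hbij, c, hτ, hc, fun j => ?_⟩
  rw [Equiv.ofBijective_apply, Equiv.ofBijective_apply, huniq (p j) _ (by simpa using hp j),
    huniq (q j) _ (by simpa using hq j)]
  exact hpq j

end Levels

/-! ### Bidiagonal matrices as syzygy matrices -/

section Bidiagonal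

variable {R : Type*} [CommRing R] {N : ℕ}

/-- The `(N + 1) × N` matrix with `t` on the diagonal and `-c j` below it. -/
def bidiag (t : R) (c : Fin N → R) : Matrix (Fin (N + 1)) (Fin N) R :=
  fun i j => if i.val = j.val then t else if i.val = j.val + 1 then -c j else 0

theorem bidiag_castSucc (t : R) (c : Fin N → R) (j : Fin N) : bidiag t c j.castSucc j = t := by
  simp [bidiag]

theorem bidiag_succ (t : R) (c : Fin N → R) (j : Fin N) : bidiag t c j.succ j = -c j := by
  simp [bidiag]

theorem bidiag_of_ne (t : R) (c : Fin N → R) {i : Fin (N + 1)} {j : Fin N} (h : i ≠ j.castSucc)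
    (h' : i ≠ j.succ) : bidiag t c i j = 0 := by
  have h₁ : ¬ i.val = j.val := fun h₀ => h (Fin.ext h₀)
  have h₂ : ¬ i.val = j.val + 1 := fun h₀ => h' (Fin.ext h₀)
  rw [bidiag, if_neg h₁, if_neg h₂]

theorem sum_bidiag_mul (t : R) (c : Fin N → R) (m : Fin (N + 1) → R) (j : Fin N) :
    ∑ i, bidiag t c i j * m i = t * m j.castSucc - c j * m j.succ := by
  have hne : j.castSucc ≠ j.succ := by simp [Fin.ext_iff]
  rw [← Finset.sum_subset (Finset.subset_univ {j.castSucc, j.succ}), Finset.sum_pair hne,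
    bidiag_castSucc, bidiag_succ]
  · ring
  · intro i _ hi
    simp only [Finset.mem_insert, Finset.mem_singleton, not_or] at hi
    rw [bidiag_of_ne t c hi.1 hi.2, zero_mul]

variable [IsDomain R]

/-- Row `j` meets only columns `j - 1` and `j`, so the coefficients vanish one after another. -/
theorem linearIndependent_bidiag_col {t : R} (ht : t ≠ 0) (c : Fin N → R) :
    LinearIndependent R (bidiag t c).col := by
  rw [Fintype.linearIndependent_iff]
  intro a ha
  have hrec : ∀ s : ℕ, ∀ j : Fin N, j.val = s → a j = 0 := by
    intro s
    induction s using Nat.strong_induction_on with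
    | _ s ih =>
      rintro j rfl
      have hj := congrFun ha j.castSucc
      rw [Finset.sum_apply, Finset.sum_eq_single j] at hj
      · simpa [Matrix.col_apply, bidiag_castSucc, ht] using hj
      · intro i _ hij
        rcases lt_or_gt_of_ne hij with h | h
        · simp [ih i h i rfl]
        · rw [Pi.smul_apply, Matrix.col_apply, bidiag_of_ne, smul_zero]
          · exact fun h₀ => hij (Fin.castSucc_injective _ h₀).symm
          · intro h₀
            have := congrArg Fin.val h₀
            simp only [Fin.val_castSucc, Fin.val_succ] at this
            have : i.val > j.val := h
            omega
      · simp
  exact fun j => hrec j j rfl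

/-- If `t` is prime, divides `m j` exactly `j` times and `t * m j = c j * m (j + 1)`, then the
bidiagonal matrix minimally generates the syzygies of `m`. -/
theorem isMinimalGenerating_bidiag {t : R} (ht : Prime t) {c : Fin N → R} {m : Fin (N + 1) → R}
    (hdvd : ∀ j, t ^ j.val ∣ m j) (hndvd : ∀ j, ¬ t ^ (j.val + 1) ∣ m j)
    (hrel : ∀ j : Fin N, t * m j.castSucc = c j * m j.succ) :
    IsMinimalGenerating (syzygies m) (bidiag t c).col := by
  refine .of_linearIndependent (le_antisymm ?_ ?_) (linearIndependent_bidiag_col ht.ne_zero c)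
  · rw [Submodule.span_le]
    rintro _ ⟨j, rfl⟩
    exact mem_syzygies.2 ((sum_bidiag_mul t c m j).trans (sub_eq_zero.2 (hrel j)))
  -- Elimination from the top: `s` leading entries of `v` are already zero, `r` remain.
  have key : ∀ r s : ℕ, s + r = N + 1 → ∀ v ∈ syzygies m, (∀ j, j.val < s → v j = 0) →
      v ∈ Submodule.span R (Set.range (bidiag t c).col) := by
    intro r
    induction r with
    | zero =>
      intro s hs v _ hv
      rw [show v = 0 from funext fun j => hv j (by have := j.2; omega)]
      exact Submodule.zero_mem _
    | succ r ih =>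
      intro s hs v hvm hv
      let s' : Fin (N + 1) := ⟨s, by omega⟩
      have hsum := mem_syzygies.1 hvm
      -- All later terms are divisible by `t ^ (s + 1)`, hence so is `v s' * m s'`; as `m s'` is
      -- not, the prime `t` divides `v s'`, and a multiple of column `s` clears this entry.
      have hdvd' : t ^ (s + 1) ∣ v s' * m s' := by
        rw [← Finset.add_sum_erase _ _ (Finset.mem_univ s')] at hsum
        rw [eq_neg_of_add_eq_zero_left hsum, dvd_neg]
        refine Finset.dvd_sum fun j hj => ?_
        rcases lt_or_gt_of_ne (Finset.ne_of_mem_erase hj) with h | h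
        · rw [hv j h, zero_mul]; exact dvd_zero _
        · exact ((pow_dvd_pow t (Nat.succ_le_of_lt h)).trans (hdvd j)).mul_left _
      obtain ⟨a, ha⟩ : t ∣ v s' := by
        by_contra h
        exact hndvd s' (ht.pow_dvd_of_dvd_mul_left _ h hdvd')
      by_cases hsN : s < N
      · let l : Fin N := ⟨s, hsN⟩
        have hcol : (bidiag t c).col l ∈ Submodule.span R (Set.range (bidiag t c).col) :=
          Submodule.subset_span ⟨l, rfl⟩
        have hcolm : (bidiag t c).col l ∈ syzygies m :=
          mem_syzygies.2 ((sum_bidiag_mul t c m l).trans (sub_eq_zero.2 (hrel l)))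
        rw [← sub_add_cancel v (a • (bidiag t c).col l)]
        refine Submodule.add_mem _ (ih (s + 1) (by omega) _ ?_ ?_) (Submodule.smul_mem _ _ hcol)
        · exact Submodule.sub_mem _ hvm (Submodule.smul_mem _ _ hcolm)
        · intro j hj
          rw [Pi.sub_apply, Pi.smul_apply, Matrix.col_apply, smul_eq_mul]
          rcases Nat.lt_succ_iff_lt_or_eq.1 hj with h | h
          · rw [hv j h, bidiag_of_ne, mul_zero, sub_zero]
            · intro h₀; rw [h₀] at h; exact lt_irrefl _ h
            · intro h₀; rw [h₀] at h; exact absurd h (by simp [l])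
          · rw [show j = s' from Fin.ext h, ha, show s' = l.castSucc from rfl, bidiag_castSucc]
            ring
      -- At the last index there is no column left, but the relation reduces to the single term `v
      -- s' * m s' = 0`.
      · have hms : m s' ≠ 0 := fun h => hndvd s' (h ▸ dvd_zero _)
        have hvs : v s' = 0 := by
          rw [Finset.sum_eq_single s'] at hsum
          · exact (mul_eq_zero.1 hsum).resolve_right hms
          · intro j _ hj
            have : j.val ≠ s := fun h => hj (Fin.ext h)
            rw [hv j (by have := j.2; omega), zero_mul]
          · simp
        refine ih (s + 1) (by omega) v hvm fun j hj => ?_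
        rcases Nat.lt_succ_iff_lt_or_eq.1 hj with h | h
        · exact hv j h
        · rw [show j = s' from Fin.ext h, hvs]
  exact fun v hv => key (N + 1) 0 (by omega) v hv (by simp)

end Bidiagonal

/-! ### Row, column and variable changes -/

section Conjugation

variable {k : Type*} [Field k]

theorem exists_GL_transpose {n : ℕ} (P : GL (Fin n) k) :
    ∃ P' : GL (Fin n) k, P'.val = P.val.transpose :=
  ⟨⟨P.val.transpose, P⁻¹.val.transpose,
    by rw [← Matrix.transpose_mul, ← Units.val_mul, inv_mul_cancel]; simp,
    by rw [← Matrix.transpose_mul, ← Units.val_mul, mul_inv_cancel]; simp⟩, rfl⟩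

theorem exists_changeVars_perm (σ : Equiv.Perm (Fin 3)) :
    ∃ g : GL (Fin 3) k, ∀ i, changeVars g.val (X i) = X (σ i) := by
  have hdet : (σ.permMatrix k).det ≠ 0 := by
    rw [Matrix.det_permutation]
    rcases Int.units_eq_one_or (Equiv.Perm.sign σ) with h | h <;> simp [h]
  refine ⟨Matrix.GeneralLinearGroup.mkOfDetNeZero _ hdet, fun i => ?_⟩
  simp [changeVars, Matrix.GeneralLinearGroup.mkOfDetNeZero, Equiv.Perm.permMatrix,
    PEquiv.toMatrix_apply, Equiv.toPEquiv_apply, apply_ite C, ite_mul]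

theorem changeVars_C (g : Matrix (Fin 3) (Fin 3) k) (a : k) : changeVars g (C a) = C a :=
  (changeVars g).commutes a

theorem isHomogeneous_map_C_mul {n m : ℕ} {d : ℕ} (A : Matrix (Fin n) (Fin n) k)
    {φ : Matrix (Fin n) (Fin m) (Poly3 k)} (hφ : ∀ i j, (φ i j).IsHomogeneous d) (i j) :
    (((A.map C : Matrix (Fin n) (Fin n) (Poly3 k)) * φ) i j).IsHomogeneous d := by
  rw [Matrix.mul_apply]
  refine IsHomogeneous.sum _ _ _ fun l _ => ?_
  simpa using (isHomogeneous_C (Fin 3) (A i l)).mul (hφ l j)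

/-- Two linear syzygy matrices of an ideal, the second one taken with respect to generators `g`,
are equivalent under row and column operations over `k`. -/
theorem IsLinearSyzygyMatrix.exists_eq_mul {n m d : ℕ} {I : Ideal (Poly3 k)} (hI : I ≠ ⊥)
    {g : Fin n → Poly3 k} (hg : ∀ i, (g i).IsHomogeneous d) (hIg : IsMinimalGenerating I g)
    {ψ : Matrix (Fin n) (Fin m) (Poly3 k)} (hψ : ∀ i j, (ψ i j).IsHomogeneous 1)
    (hgψ : IsMinimalGenerating (syzygies g) ψ.col)
    {φ : Matrix (Fin n) (Fin m) (Poly3 k)} (hφ : IsLinearSyzygyMatrix I φ) :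
    ∃ (P : GL (Fin n) k) (Q : GL (Fin m) k),
      ψ = (P.val.map C : Matrix (Fin n) (Fin n) (Poly3 k)) * φ *
        (Q.val.map C : Matrix (Fin m) (Fin m) (Poly3 k)) := by
  obtain ⟨hφ1, d', f, hf, hIf, hfφ⟩ := hφ
  obtain rfl := degree_eq_of_ideal hI hf hg hIf hIg
  obtain ⟨P, hP⟩ := exists_GL_of_ideal hg hf hIg hIf
  -- Once rewritten in the generators `g`, both matrices minimally generate the same syzygy module.
  have hgφ := isMinimalGenerating_syzygies_transpose_mul P hP hfφ
  obtain ⟨Q, hQ⟩ := exists_GL_of_pi (fun j i => isHomogeneous_map_C_mul P.val.transpose hφ1 i j)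
    (fun j i => hψ i j) hgφ hgψ
  obtain ⟨P', hP'⟩ := exists_GL_transpose P
  obtain ⟨Q', hQ'⟩ := exists_GL_transpose Q
  refine ⟨P', Q', ?_⟩
  rw [hP', hQ']
  ext1 i j
  have hij := congrFun (hQ j) i
  rw [Matrix.mul_apply]
  simp only [Finset.sum_apply, Pi.smul_apply, smul_eq_C_mul] at hij
  rw [hij]
  refine Finset.sum_congr rfl fun l _ => ?_
  rw [mul_comm]
  rfl

/-- The syzygies of minimal generators of one degree of a linearly presented ideal are generated
by linear ones. -/
theorem IsLinearlyPresented.exists_span_eq_syzygies {n d : ℕ} {I : Ideal (Poly3 k)} (hI : I ≠ ⊥)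
    (hlin : IsLinearlyPresented I)
    {g : Fin n → Poly3 k} (hg : ∀ i, (g i).IsHomogeneous d) (hIg : IsMinimalGenerating I g) :
    ∃ L : Set (Fin n → Poly3 k), Submodule.span (Poly3 k) L = syzygies g ∧
      ∀ v ∈ L, ∀ i, (v i).IsHomogeneous 1 := by
  obtain ⟨n', m, φ, hφ1, d', f, hf, hIf, hfφ⟩ := hlin
  -- The presentation may use other generators; their degree and number are forced to agree with
  -- those of `g`.
  obtain rfl := degree_eq_of_ideal hI hf hg hIf hIg
  obtain rfl := card_eq_of_ideal hf hg hIf hIg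
  obtain ⟨P, hP⟩ := exists_GL_of_ideal hg hf hIg hIf
  refine ⟨_, (isMinimalGenerating_syzygies_transpose_mul P hP hfφ).1, ?_⟩
  rintro _ ⟨j, rfl⟩ i
  exact isHomogeneous_map_C_mul P.val.transpose hφ1 i j

theorem X_pow_dvd_monomial_iff {t : Fin 3} {a : ℕ} {e : Fin 3 →₀ ℕ} :
    (X t : Poly3 k) ^ a ∣ monomial e 1 ↔ a ≤ e t := by
  rw [X_pow_eq_monomial, monomial_dvd_monomial]
  simp [Finsupp.single_le_iff]

theorem isHomogeneous_bidiag {N : ℕ} (t : Fin 3) (c : Fin N → Fin 3) (i j) :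
    (bidiag (X t : Poly3 k) (fun j => X (c j)) i j).IsHomogeneous 1 := by
  unfold bidiag
  split_ifs
  · exact isHomogeneous_X _ _
  · exact (isHomogeneous_X _ _).neg
  · exact isHomogeneous_zero _ _ _

end Conjugation

end MonomialSyzygy

/-! ### The main theorem -/

open MonomialSyzygy in
theorem mainTheorem8 {k : Type*} [Field k] (n : ℕ)
    (I : Ideal (MonomialSyzygy.Poly3 k))
    (hlin : MonomialSyzygy.IsLinearlyPresented I)
    (hcodim : I.height = 2)
    (hperf : MonomialSyzygy.IsPerfect I)
    (hmon : ∃ e : Fin n → (Fin 3 →₀ ℕ), (∀ i, (e i).degree + 1 = n) ∧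
      MonomialSyzygy.IsMinimalGenerating I (fun i => MvPolynomial.monomial (e i) (1 : k)))
    (hmin : I.minimalPrimes.ncard = 2) :
    ∃ c : Fin (n - 1) → MonomialSyzygy.Poly3 k,
      (∀ j, c j = MvPolynomial.X 0 ∨ c j = MvPolynomial.X 1) ∧
      (∃ φ : Matrix (Fin n) (Fin (n - 1)) (MonomialSyzygy.Poly3 k),
        MonomialSyzygy.IsLinearSyzygyMatrix I φ) ∧
      ∀ φ : Matrix (Fin n) (Fin (n - 1)) (MonomialSyzygy.Poly3 k),
        MonomialSyzygy.IsLinearSyzygyMatrix I φ →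
          MonomialSyzygy.IsConjugate φ (MonomialSyzygy.bidiagonal c) := by
  obtain ⟨e, hdeg, hgen⟩ := hmon
  have hI : I ≠ ⊥ := by
    rintro rfl
    rw [Ideal.height_bot] at hcodim
    exact absurd hcodim (by decide)
  obtain _ | N := n
  · exact absurd hgen.1.symm (by rw [Set.range_eq_empty, Submodule.span_empty]; exact hI)
  change ∃ c : Fin N → Poly3 k, _ ∧
    (∃ φ : Matrix (Fin (N + 1)) (Fin N) (Poly3 k), IsLinearSyzygyMatrix I φ) ∧
    ∀ φ : Matrix (Fin (N + 1)) (Fin N) (Poly3 k), IsLinearSyzygyMatrix I φ → IsConjugate φ _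
  have hdeg' (i : Fin (N + 1)) : (e i).degree = N := Nat.succ_injective (hdeg i)
  have hhom (i : Fin (N + 1)) : (MvPolynomial.monomial (e i) (1 : k)).IsHomogeneous N :=
    MvPolynomial.isHomogeneous_monomial _ (hdeg' i)
  obtain ⟨L, hL, hL1⟩ := hlin.exists_span_eq_syzygies hI hhom hgen
  obtain ⟨t, i₁, hi₁⟩ := exists_pure_power hcodim hmin hgen.1
  obtain ⟨i₀, hi₀⟩ := exists_exponent_eq_zero hcodim hgen.1 t
  have hi₁t : e i₁ t = N := by
    rw [← hdeg' i₁, Finsupp.degree_eq_sum, Finset.sum_eq_single t (fun j _ => hi₁ j) (by simp)]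
  obtain ⟨τ, c, hτ, hc, hchain⟩ := exists_equiv_chain hL hL1 t hi₀ hi₁t
  have hgenτ := hgen.comp_equiv τ
  have hsyz := isMinimalGenerating_bidiag (MvPolynomial.X_prime (i := t) (R := k))
    (c := fun j => MvPolynomial.X (c j)) (m := fun j => MvPolynomial.monomial (e (τ j)) (1 : k))
    (fun j => X_pow_dvd_monomial_iff.2 (hτ j).ge)
    (fun j h => absurd (X_pow_dvd_monomial_iff.1 h) (by rw [hτ j]; omega))
    (fun j => by
      simp only [MvPolynomial.X, MvPolynomial.monomial_mul, mul_one]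
      rw [add_comm, hchain j, add_comm])
  -- The swap sends `X t` to `z`, so the `c j ≠ t` land in `{x, y}`.
  obtain ⟨g, hg⟩ := exists_changeVars_perm (k := k) (Equiv.swap t 2)
  refine ⟨fun j => MvPolynomial.X (Equiv.swap t 2 (c j)), fun j => ?_,
    ⟨_, isHomogeneous_bidiag t c, N, _, fun i => hhom (τ i), hgenτ, hsyz⟩, fun φ hφ => ?_⟩
  · have hne : Equiv.swap t 2 (c j) ≠ 2 := fun h =>
      hc j ((Equiv.swap t 2).injective (h.trans (Equiv.swap_apply_left t 2).symm))
    change MvPolynomial.X (Equiv.swap t 2 (c j)) = _ ∨ MvPolynomial.X (Equiv.swap t 2 (c j)) = _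
    generalize Equiv.swap t 2 (c j) = s at hne
    fin_cases s
    · exact Or.inl rfl
    · exact Or.inr rfl
    · exact absurd rfl hne
  · obtain ⟨P, Q, hPQ⟩ := hφ.exists_eq_mul hI (fun i => hhom (τ i)) hgenτ
      (isHomogeneous_bidiag t c) hsyz
    have hmapC {r : ℕ} (A : Matrix (Fin r) (Fin r) k) :
        (A.map MvPolynomial.C : Matrix (Fin r) (Fin r) (Poly3 k)).map (changeVars g.val) =
          A.map MvPolynomial.C := by
      ext1 i j
      exact changeVars_C _ _
    refine ⟨g, P, Q, ?_⟩
    -- The variable change fixes scalar matrices, so it passes through `P` and `Q` to `φ`.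
    have hmap := congrArg (fun A => A.map (changeVars g.val)) hPQ
    simp only [Matrix.map_mul, hmapC] at hmap
    rw [← hmap]
    ext1 i j
    simp only [bidiagonal, bidiag, Matrix.map_apply]
    split_ifs
    · rw [hg, Equiv.swap_apply_left]
    · rw [map_neg, hg]
    · rw [map_zero]
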